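/- Let $X$ be a complex separable Banach space and let $T\colon X\to X$ be a bounded linear operator. A vector $x\in X$ is recurrent for $T$ if $T^{k_n}x\to x$ for some strictly increasing sequence $(k_n)_{n\in\mathbb N}$ of non-negative integers; a recurrent subspace for $T$ is an infinite-dimensional closed subspace $Z\subset X$ all of whose vectors are recurrent for $T$; and $T$ is quasi-rigid if there are a strictly increasing sequence $(k_n)_{n\in\mathbb N}$ of non-negative integers and a dense subset $Y\subset X$ such that $T^{k_n}x\to x$ for all $x\in Y$. Let $\mathcal L(X)$ be the algebra of bounded linear operators on $X$, let $\mathcal K(X)$ be its two-sided ideal of compact operators, and let the essential spectrum $\sigma_e(T)$ be the set of all $\lambda\in\mathbb C$ such that the class of $T-\lambda$ is not invertible in the quotient algebra $\mathcal L(X)/\mathcal K(X)$. **Theorem.** If $T$ is quasi-rigid, then the following statements are equivalent: (i) $T$ has a recurrent subspace; (ii) there exist an infinite-dimensional closed subspace $E\subset X$ and a strictly increasing sequence $(l_n)_{n\in\mathbb N}$ of non-negative integers such that $T^{l_n}x\to x$ for all $x\in E$; (iii) there exist an infinite-dimensional closed subspace $E\subset X$ and a strictly increasing sequence $(l_n)_{n\in\mathbb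 N}$ of non-negative integers such that $\sup_{n\in\mathbb N}\|T^{l_n}|_E\|<\infty$; (iv) the essential spectrum of $T$ meets the closed unit disk, i.e. $\sigma_e(T)\cap\{z\in\mathbb C:|z|\le 1\}\neq\varnothing$. -/

import Mathlib

open Filter Topology

/-- The two-sided ideal `K(X)` of compact operators in the ring `L(X)` of bounded operators
on a complex normed space `X` (two-sidedness is the instance below). -/
def compactIdeal (X : Type*) [NormedAddCommGroup X] [NormedSpace ℂ X] :
    Ideal (X →L[ℂ] X) where
  carrier := {K | IsCompactOperator K}
  add_mem' := fun ha hb => ha.add hb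
  zero_mem' := isCompactOperator_zero
  smul_mem' := fun S _ hK => hK.clm_comp S

instance compactIdeal_isTwoSided (X : Type*) [NormedAddCommGroup X] [NormedSpace ℂ X] :
    (compactIdeal X).IsTwoSided :=
  ⟨fun S hK => IsCompactOperator.comp_clm hK S⟩

/-- The Calkin algebra `L(X) / K(X)`; its ring structure is the quotient structure. -/
abbrev CalkinAlgebra (X : Type*) [NormedAddCommGroup X] [NormedSpace ℂ X] : Type _ :=
  (X →L[ℂ] X) ⧸ compactIdeal X

/-- The class of an operator in the Calkin algebra. -/
def toCalkin {X : Type*} [NormedAddCommGroup X] [NormedSpace ℂ X] :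
    (X →L[ℂ] X) →+* CalkinAlgebra X :=
  Ideal.Quotient.mk (compactIdeal X)

/-- The essential spectrum `σ_e(T)`: the complex numbers `z` such that the class of `T - z` is not
(two-sided) invertible in the Calkin algebra. -/
def essentialSpectrum {X : Type*} [NormedAddCommGroup X] [NormedSpace ℂ X]
    (T : X →L[ℂ] X) : Set ℂ :=
  {z | ¬ IsUnit (toCalkin (T - z • ContinuousLinearMap.id ℂ X))}

/-- `x` is recurrent for `T`: `T^{k_n} x → x` along some (strictly) increasing sequence `(k_n)`. -/
def IsRecurrentVector {X : Type*} [NormedAddCommGroup X] [NormedSpace ℂ X]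
    (T : X →L[ℂ] X) (x : X) : Prop :=
  ∃ k : ℕ → ℕ, StrictMono k ∧ Tendsto (fun n => (T ^ k n) x) atTop (𝓝 x)

/-- A closed infinite-dimensional (complex) linear subspace. -/
def IsInfDimClosed {X : Type*} [NormedAddCommGroup X] [NormedSpace ℂ X]
    (E : Submodule ℂ X) : Prop :=
  IsClosed (E : Set X) ∧ ¬ FiniteDimensional ℂ E

/-- `T` has a recurrent subspace: an infinite-dimensional closed subspace all of whose vectors are
recurrent for `T`. -/
def HasRecurrentSubspace {X : Type*} [NormedAddCommGroup X] [NormedSpace ℂ X]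
    (T : X →L[ℂ] X) : Prop :=
  ∃ Z : Submodule ℂ X, IsInfDimClosed Z ∧ ∀ x ∈ Z, IsRecurrentVector T x

/-- `T` is quasi-rigid: for one increasing sequence `(k_n)`, `T^{k_n} x → x` for all `x` in some
dense set. -/
def IsQuasiRigid {X : Type*} [NormedAddCommGroup X] [NormedSpace ℂ X]
    (T : X →L[ℂ] X) : Prop :=
  ∃ k : ℕ → ℕ, StrictMono k ∧
    ∃ Y : Set X, Dense Y ∧ ∀ x ∈ Y, Tendsto (fun n => (T ^ k n) x) atTop (𝓝 x)

/-! Suppose `σ_e(T)` misses the closed disk. Then the class of `T` in the Calkin algebra has an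
inverse with spectrum in the open disk, so its powers decay like `r ^ n` with `r < 1`. Lifting them
gives `S * T ^ n = 1 + K` with `‖S‖ ≤ r ^ n` and `K` compact, and `K` is small on a subspace of
finite codimension. There `T ^ n` expands by `r⁻¹ ^ n / 2` (`exists_geometric_growth`). This
excludes bounded powers on an infinite-dimensional subspace, and a gliding hump turns it into an
orbit tending to infinity in every closed infinite-dimensional subspace
(`exists_tendsto_norm_pow_atTop`), which excludes recurrence.

Conversely, let `z ∈ σ_e(T)` with `‖z‖ ≤ 1`. Quasi-rigidity makes `T - μ` of dense range for `‖μ‖ <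
1`. If `T - z` were bounded below on a closed `M` of finite codimension, letting `μ → z` would bound
the codimension of `(T - z) M`, so `T - z` would be Fredholm. Hence approximate eigenvectors for `z`
exist in every common kernel of finitely many functionals, and by density also in the rigidity
domain. They are assembled into a basic sequence `e n`, chosen alternately with exponents `l n`: `T
^ l m` is close to the identity on earlier vectors and to the scalar `z ^ l m`, of modulus at most
1, on later ones. So these powers are uniformly bounded on the closed span and converge there to the
identity. -/

/-! ### Quotient Banach algebras and the spectral radius -/

section TwoSidedQuotient

variable {R : Type*} [NormedRing R] (I : Ideal R) [I.IsTwoSided] [hI : IsClosed (I : Set R)]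

/-- The quotient of a normed ring by a closed two-sided ideal is a normed ring. -/
noncomputable abbrev quotientNormedRing : NormedRing (R ⧸ I) :=
  { Submodule.Quotient.normedAddCommGroup I, Ideal.Quotient.ring I with
    norm_mul_le := fun x y => by
      refine le_of_forall_gt_imp_ge_of_dense fun c hc => ?_
      have hcont : Tendsto (fun ε : ℝ => (‖x‖ + ε) * (‖y‖ + ε)) (𝓝[>] 0) (𝓝 (‖x‖ * ‖y‖)) := by
        have : Continuous fun ε : ℝ => (‖x‖ + ε) * (‖y‖ + ε) := by fun_prop
        simpa using (this.tendsto 0).mono_left nhdsWithin_le_nhds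
      obtain ⟨ε, hεc, hε⟩ := ((hcont.eventually_lt_const hc).and self_mem_nhdsWithin).exists
      obtain ⟨a, rfl, ha⟩ := Submodule.Quotient.norm_mk_lt x hε
      obtain ⟨b, rfl, hb⟩ := Submodule.Quotient.norm_mk_lt y hε
      calc _ ≤ ‖a * b‖ := Submodule.Quotient.norm_mk_le I (a * b)
        _ ≤ ‖a‖ * ‖b‖ := norm_mul_le a b
        _ ≤ _ := mul_le_mul ha.le hb.le (norm_nonneg _) ((norm_nonneg _).trans ha.le)
        _ ≤ c := hεc.le }

/-- The quotient of a normed algebra by a closed two-sided ideal is a normed algebra. -/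
noncomputable abbrev quotientNormedAlgebra [NormedAlgebra ℂ R] :
    letI := quotientNormedRing I
    NormedAlgebra ℂ (R ⧸ I) :=
  letI := quotientNormedRing I
  { Submodule.Quotient.normedSpace I ℂ, Ideal.Quotient.algebra ℂ with }

end TwoSidedQuotient

/-- In a complex Banach algebra, if `a - z` is invertible for all `z` in the closed unit disk, then
the powers of the inverse of `a` decay geometrically. -/
theorem exists_norm_inv_pow_le {A : Type*} [NormedRing A] [NormedAlgebra ℂ A] [CompleteSpace A]
    (a : A) (h : ∀ z : ℂ, ‖z‖ ≤ 1 → IsUnit (a - algebraMap ℂ A z)) :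
    ∃ b : A, b * a = 1 ∧ ∃ r : ℝ, 0 < r ∧ r < 1 ∧ ∀ᶠ n in atTop, ‖b ^ n‖ < r ^ n := by
  obtain ⟨u, hu⟩ : IsUnit a := by simpa using h 0 (by simp)
  refine ⟨(↑u⁻¹ : A), by rw [← hu]; simp, ?_⟩
  -- Inversion maps the spectrum of `a`, which lies outside the closed disk, into the open disk.
  have hspec : ∀ z ∈ spectrum ℂ (↑u⁻¹ : A), ‖z‖₊ < 1 := by
    intro z hz
    have hz0 : z ≠ 0 := by
      rintro rfl
      exact spectrum.zero_notMem ℂ (Units.isUnit u⁻¹) hz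
    lift z to ℂˣ using hz0.isUnit
    have hz' : (↑z⁻¹ : ℂ) ∈ spectrum ℂ (u : A) := by
      have := (spectrum.inv_mem_iff (r := z) (a := u⁻¹)).1 hz
      simpa using this
    by_contra hlt
    rw [spectrum.mem_iff, hu] at hz'
    refine hz' ?_
    rw [← neg_sub, IsUnit.neg_iff]
    refine h _ ?_
    rw [Units.val_inv_eq_inv_val, norm_inv]
    exact inv_le_one_of_one_le₀ (by simpa [← NNReal.coe_le_coe] using hlt)
  have hrad : spectralRadius ℂ (↑u⁻¹ : A) < (1 : NNReal) := by
    -- The zero algebra does occur: it is the Calkin algebra of a finite-dimensional space.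
    rcases subsingleton_or_nontrivial A with hA | hA
    · simp [spectralRadius, spectrum.of_subsingleton]
    · exact spectrum.spectralRadius_lt_of_forall_lt _ hspec
  obtain ⟨r, hr0, hr1⟩ := ENNReal.lt_iff_exists_nnreal_btwn.1 hrad
  have hr0' : 0 < r := by
    have := hr0.bot_lt
    simpa [ENNReal.bot_eq_zero] using this
  refine ⟨r, by exact_mod_cast hr0', by exact_mod_cast hr1, ?_⟩
  -- Gelfand's formula, with `r` strictly between the spectral radius and 1.
  have key := (spectrum.pow_nnnorm_pow_one_div_tendsto_nhds_spectralRadius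
    (↑u⁻¹ : A)).eventually_lt_const hr0
  filter_upwards [key, eventually_gt_atTop 0] with n hn hn0
  have hn0' : (n : ℝ) ≠ 0 := by exact_mod_cast hn0.ne'
  have h2 := ENNReal.rpow_lt_rpow hn (z := (n : ℝ)) (by positivity)
  rw [← ENNReal.rpow_mul, one_div, inv_mul_cancel₀ hn0', ENNReal.rpow_one,
    ENNReal.rpow_natCast] at h2
  have h3 : ‖(↑u⁻¹ : A) ^ n‖₊ < r ^ n := by exact_mod_cast h2
  exact_mod_cast h3

/-! ### Inverses modulo compact operators -/

section OperatorTheory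

variable {X : Type*} [NormedAddCommGroup X] [NormedSpace ℂ X]

theorem isClosed_compactIdeal [CompleteSpace X] :
    IsClosed (compactIdeal X : Set (X →L[ℂ] X)) :=
  isClosed_setOfPred_isCompactOperator

theorem isUnit_toCalkin_of_isCompactOperator_sub {A S : X →L[ℂ] X}
    (h₁ : S * A - 1 ∈ compactIdeal X) (h₂ : A * S - 1 ∈ compactIdeal X) :
    IsUnit (toCalkin A) := by
  have h₁' : toCalkin S * toCalkin A = 1 := by
    rw [← map_mul, ← map_one toCalkin]
    exact Ideal.Quotient.eq.2 h₁
  have h₂' : toCalkin A * toCalkin S = 1 := by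
    rw [← map_mul, ← map_one toCalkin]
    exact Ideal.Quotient.eq.2 h₂
  exact ⟨⟨_, _, h₂', h₁'⟩, rfl⟩

/-- If the essential spectrum misses the closed unit disk, the powers of the operator have left
inverses modulo compact operators with geometrically decaying norms. -/
theorem exists_left_parametrix_pow [CompleteSpace X] (T : X →L[ℂ] X)
    (h : ¬ (essentialSpectrum T ∩ Metric.closedBall (0 : ℂ) 1).Nonempty) :
    ∃ r : ℝ, 0 < r ∧ r < 1 ∧ ∀ᶠ n in atTop, ∃ S : X →L[ℂ] X,
      ‖S‖ ≤ r ^ n ∧ S * T ^ n - 1 ∈ compactIdeal X := by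
  have := isClosed_compactIdeal (X := X)
  let _ := quotientNormedRing (compactIdeal X)
  let _ := quotientNormedAlgebra (compactIdeal X)
  have : CompleteSpace (CalkinAlgebra X) := Submodule.Quotient.completeSpace (compactIdeal X)
  have hunit : ∀ z : ℂ, ‖z‖ ≤ 1 →
      IsUnit (toCalkin T - algebraMap ℂ (CalkinAlgebra X) z) := by
    intro z hz
    by_contra hcon
    refine h ⟨z, ?_, by simpa using hz⟩
    have : toCalkin (T - z • ContinuousLinearMap.id ℂ X) =
      toCalkin T - algebraMap ℂ (CalkinAlgebra X) z := by
      rw [map_sub]; rfl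
    simpa only [essentialSpectrum, Set.mem_ofPred_eq, this] using hcon
  obtain ⟨b, hb, r, hr0, hr1, hr⟩ := exists_norm_inv_pow_le (toCalkin T) hunit
  refine ⟨r, hr0, hr1, hr.mono fun n hn => ?_⟩
  -- The quotient norm is an infimum over lifts; the strict bound on `‖b ^ n‖` leaves room for a
  -- lift of norm below `r ^ n`.
  obtain ⟨S, hS, hSn⟩ := Submodule.Quotient.norm_mk_lt (b ^ n) (sub_pos.2 hn)
  refine ⟨S, by linarith, ?_⟩
  have hpow : ∀ m : ℕ, b ^ m * toCalkin T ^ m = 1 := by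
    intro m
    induction m with
    | zero => simp
    | succ m ih =>
      rw [pow_succ, pow_succ', mul_assoc, ← mul_assoc b, hb, one_mul, ih]
  have : toCalkin (S * T ^ n) = toCalkin 1 := by
    rw [map_mul, map_pow, map_one, ← hpow n]
    congr 1
  exact Ideal.Quotient.eq.1 this

/-! ### Common kernels and geometric growth -/

/-- The common kernel of finitely many continuous functionals. -/
def commonKer (Φ : Finset (StrongDual ℂ X)) : Submodule ℂ X where
  carrier := {x | ∀ f ∈ Φ, f x = 0}
  add_mem' hx hy f hf := by simp [hx f hf, hy f hf]
  zero_mem' f _ := map_zero f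
  smul_mem' c x hx f hf := by simp [hx f hf]

theorem mem_commonKer {Φ : Finset (StrongDual ℂ X)} {x : X} :
    x ∈ commonKer Φ ↔ ∀ f ∈ Φ, f x = 0 := Iff.rfl

theorem commonKer_antitone {Φ Ψ : Finset (StrongDual ℂ X)} (h : Φ ⊆ Ψ) :
    commonKer Ψ ≤ commonKer Φ := fun _ hx f hf => hx f (h hf)

theorem commonKer_eq_ker (Φ : Finset (StrongDual ℂ X)) :
    commonKer Φ = LinearMap.ker (LinearMap.pi fun f : Φ => (f : StrongDual ℂ X).toLinearMap) := by
  ext x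
  simp [mem_commonKer, funext_iff]

theorem isClosed_commonKer (Φ : Finset (StrongDual ℂ X)) :
    IsClosed (commonKer Φ : Set X) := by
  have : (commonKer Φ : Set X) = ⋂ f ∈ Φ, {x | f x = 0} := by
    ext x; simp [mem_commonKer]
  rw [this]
  exact isClosed_biInter fun f _ => isClosed_eq f.continuous continuous_const

instance cofg_commonKer (Φ : Finset (StrongDual ℂ X)) : (commonKer Φ).CoFG := by
  rw [commonKer_eq_ker]
  exact Submodule.CoFG.ker _

/-- An infinite-dimensional subspace meets every subspace of finite codimension. -/
theorem exists_ne_zero_mem_of_cofg {E M : Submodule ℂ X} (hE : ¬ FiniteDimensional ℂ E)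
    (hM : M.CoFG) : ∃ x ∈ E, x ∈ M ∧ x ≠ 0 := by
  by_contra! hcon
  refine hE ?_
  have hinj : Function.Injective (M.mkQ ∘ₗ E.subtype) := by
    rw [← LinearMap.ker_eq_bot, LinearMap.ker_eq_bot']
    intro x hx
    have : (x : X) ∈ M := by simpa using hx
    exact Subtype.ext (hcon x x.2 this)
  exact Module.Finite.of_injective _ hinj

theorem exists_norm_eq_one_mem_commonKer {E : Submodule ℂ X} (hE : ¬ FiniteDimensional ℂ E)
    (Φ : Finset (StrongDual ℂ X)) : ∃ x ∈ E, x ∈ commonKer Φ ∧ ‖x‖ = 1 := by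
  obtain ⟨x, hxE, hxM, hx⟩ := exists_ne_zero_mem_of_cofg hE (cofg_commonKer Φ)
  refine ⟨(‖x‖⁻¹ : ℂ) • x, E.smul_mem _ hxE, (commonKer Φ).smul_mem _ hxM, ?_⟩
  rw [norm_smul, norm_inv, Complex.norm_real, norm_norm, inv_mul_cancel₀ (norm_ne_zero_iff.2 hx)]

/-- A compact operator is small on some subspace of finite codimension. -/
theorem IsCompactOperator.exists_norm_le_on_commonKer {K : X →L[ℂ] X} (hK : IsCompactOperator K)
    {ε : ℝ} (hε : 0 < ε) :
    ∃ Φ : Finset (StrongDual ℂ X), ∀ x ∈ commonKer Φ, ‖K x‖ ≤ ε * ‖x‖ := by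
  classical
  have htb : TotallyBounded (K '' Metric.closedBall 0 1) :=
    (hK.isCompact_closure_image_closedBall (f := K.toLinearMap) 1).totallyBounded.subset
      subset_closure
  obtain ⟨t, htf, ht⟩ := Metric.totallyBounded_iff.1 htb (ε / 2) (by positivity)
  choose g hg1 hg2 using fun y : X => exists_dual_vector'' ℂ y
  -- If the functional norming the net point `y` kills `K z`, then `‖y‖ ≤ ‖K z - y‖ < ε / 2`, hence
  -- `‖K z‖ < ε`.
  refine ⟨htf.toFinset.image fun y => (g y).comp K, fun x hx => ?_⟩
  have key : ∀ z ∈ commonKer (htf.toFinset.image fun y => (g y).comp K), ‖z‖ ≤ 1 →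
      ‖K z‖ ≤ ε := by
    intro z hz hz1
    obtain ⟨y, hyt, hy⟩ := Set.mem_iUnion₂.1 (ht (Set.mem_image_of_mem K
      (mem_closedBall_zero_iff.2 hz1)))
    rw [mem_ball_iff_norm] at hy
    have hgz : g y (K z) = 0 :=
      hz ((g y).comp K) (Finset.mem_image_of_mem _ (htf.mem_toFinset.2 hyt))
    have hyn : ‖y‖ ≤ ‖K z - y‖ := by
      have h1 : ‖g y (K z - y)‖ = ‖y‖ := by
        rw [map_sub, hgz, hg2, zero_sub, norm_neg, RCLike.norm_ofReal, abs_norm]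
      rw [← h1]
      exact ((g y).le_opNorm _).trans (mul_le_of_le_one_left (norm_nonneg _) (hg1 y))
    have := norm_le_norm_sub_add (K z) y
    linarith
  rcases eq_or_ne x 0 with rfl | hx0
  · simp
  have hxn : 0 < ‖x‖ := norm_pos_iff.2 hx0
  have h1 := key ((‖x‖⁻¹ : ℂ) • x) ((commonKer _).smul_mem _ hx) (by
    rw [norm_smul, norm_inv, Complex.norm_real, norm_norm, inv_mul_cancel₀ hxn.ne'])
  rw [map_smul, norm_smul, norm_inv, Complex.norm_real, norm_norm, inv_mul_le_iff₀ hxn] at h1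
  linarith

/-- If the essential spectrum misses the closed unit disk, the powers of `T` grow geometrically on
subspaces of finite codimension. -/
theorem exists_geometric_growth [CompleteSpace X] (T : X →L[ℂ] X)
    (h : ¬ (essentialSpectrum T ∩ Metric.closedBall (0 : ℂ) 1).Nonempty) :
    ∃ r : ℝ, 0 < r ∧ r < 1 ∧ ∀ᶠ n in atTop, ∃ Φ : Finset (StrongDual ℂ X),
      ∀ x ∈ commonKer Φ, ‖x‖ ≤ 2 * r ^ n * ‖(T ^ n) x‖ := by
  obtain ⟨r, hr0, hr1, hr⟩ := exists_left_parametrix_pow T h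
  refine ⟨r, hr0, hr1, hr.mono fun n hn => ?_⟩
  obtain ⟨S, hS, hK⟩ := hn
  -- With `ε = 1 / 2`, at least half of `‖x‖` survives in `S (T ^ n x)`; this is the factor 2.
  obtain ⟨Φ, hΦ⟩ := IsCompactOperator.exists_norm_le_on_commonKer (K := S * T ^ n - 1) hK
    (ε := 1 / 2) (by norm_num)
  refine ⟨Φ, fun x hx => ?_⟩
  have h1 : ‖S ((T ^ n) x) - x‖ ≤ 1 / 2 * ‖x‖ := hΦ x hx
  have h2 : ‖S ((T ^ n) x)‖ ≤ r ^ n * ‖(T ^ n) x‖ := S.le_of_opNorm_le hS _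
  have h3 := norm_le_norm_sub_add x (S ((T ^ n) x))
  rw [norm_sub_rev] at h3
  linarith

/-- Powers that are uniformly bounded along a sequence on an infinite-dimensional subspace force
the essential spectrum to meet the closed unit disk. -/
theorem essentialSpectrum_inter_nonempty_of_bddAbove [CompleteSpace X] (T : X →L[ℂ] X)
    {E : Submodule ℂ X} (hE : ¬ FiniteDimensional ℂ E) {l : ℕ → ℕ} (hl : StrictMono l)
    (hb : BddAbove (Set.range fun n => ‖(T ^ l n).comp E.subtypeL‖)) :
    (essentialSpectrum T ∩ Metric.closedBall (0 : ℂ) 1).Nonempty := by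
  by_contra hcon
  obtain ⟨r, hr0, hr1, hr⟩ := exists_geometric_growth T hcon
  obtain ⟨B, hB⟩ := hb
  have hlim : Tendsto (fun n => 2 * r ^ l n * B) atTop (𝓝 0) := by
    simpa using (((tendsto_pow_atTop_nhds_zero_of_lt_one hr0.le hr1).comp
      hl.tendsto_atTop).const_mul 2).mul_const B
  obtain ⟨n, ⟨Φ, hΦ⟩, hn⟩ :=
    ((hl.tendsto_atTop.eventually hr).and (hlim.eventually_lt_const one_pos)).exists
  obtain ⟨x, hxE, hxΦ, hx1⟩ := exists_norm_eq_one_mem_commonKer hE Φ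
  have h1 := hΦ x hxΦ
  have h2 : ‖(T ^ l n) x‖ ≤ B := by
    have := ((T ^ l n).comp E.subtypeL).le_of_opNorm_le (hB ⟨n, rfl⟩) ⟨x, hxE⟩
    simpa [hx1] using this
  have : 2 * r ^ l n * ‖(T ^ l n) x‖ ≤ 2 * r ^ l n * B := by gcongr
  linarith

/-- Lets the sign of each hump be chosen so that it is not cancelled by the vector built so far. -/
theorem norm_le_norm_add_or_norm_sub (u v : X) : ‖v‖ ≤ ‖u + v‖ ∨ ‖v‖ ≤ ‖u - v‖ := by
  by_contra! hcon
  have h1 : ‖(2 : ℂ) • v‖ ≤ ‖u + v‖ + ‖u - v‖ := by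
    have : (2 : ℂ) • v = (u + v) - (u - v) := by rw [two_smul]; abel
    rw [this]
    exact norm_sub_le _ _
  rw [norm_smul] at h1
  norm_num at h1
  linarith

/-- If the powers of `T` grow geometrically on subspaces of finite codimension, every
infinite-dimensional closed subspace contains a vector whose orbit tends to infinity. -/
theorem exists_tendsto_norm_pow_atTop [CompleteSpace X] (T : X →L[ℂ] X) {r : ℝ} (hr0 : 0 < r)
    (hr1 : r < 1) (hr : ∀ᶠ n in atTop, ∃ Φ : Finset (StrongDual ℂ X),
      ∀ x ∈ commonKer Φ, ‖x‖ ≤ 2 * r ^ n * ‖(T ^ n) x‖)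
    {E : Submodule ℂ X} (hE : IsInfDimClosed E) :
    ∃ x ∈ E, Tendsto (fun n => ‖(T ^ n) x‖) atTop atTop := by
  classical
  obtain ⟨N, hN⟩ := eventually_atTop.1 hr
  have hΦ : ∀ n, ∃ Φ : Finset (StrongDual ℂ X), N ≤ n →
      ∀ x ∈ commonKer Φ, ‖x‖ ≤ 2 * r ^ n * ‖(T ^ n) x‖ := fun n => by
    by_cases hn : N ≤ n
    · obtain ⟨Φ, h⟩ := hN n hn
      exact ⟨Φ, fun _ => h⟩
    · exact ⟨∅, fun h => absurd h hn⟩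
  choose Φ hΦ using hΦ
  -- Humps of size `ρ ^ n` with `ρ = √r` are summable, yet `T ^ n` magnifies them to at least `ρ ^ n
  -- / (2 * r ^ n) = ρ⁻¹ ^ n / 2`.
  obtain ⟨ρ, hρ0, hρr⟩ : ∃ ρ : ℝ, 0 < ρ ∧ ρ * ρ = r :=
    ⟨√r, Real.sqrt_pos.2 hr0, Real.mul_self_sqrt hr0.le⟩
  have hρ1 : ρ < 1 := by nlinarith
  -- The state is the current vector with the functionals to be preserved. Step `n` adds a hump in
  -- their common kernel, then records `f ∘ T ^ n` with `f` norming the new `T ^ n` image.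
  have hstep : ∀ (n : ℕ) (s : E × Finset (StrongDual ℂ X)), ∃ s' : E × Finset (StrongDual ℂ X),
      ‖s'.1 - s.1‖ ≤ ρ ^ n ∧ ((s'.1 - s.1 : E) : X) ∈ commonKer s.2 ∧ s.2 ⊆ s'.2 ∧
      (∃ f : StrongDual ℂ X, ‖f‖ ≤ 1 ∧ f ((T ^ n) s'.1) = ‖(T ^ n) (s'.1 : X)‖ ∧
        f.comp (T ^ n) ∈ s'.2) ∧
      (N ≤ n → ρ ^ n ≤ 2 * r ^ n * ‖(T ^ n) (s'.1 : X)‖) := by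
    rintro n ⟨y, Ψ⟩
    obtain ⟨e, heE, heK, he1⟩ := exists_norm_eq_one_mem_commonKer hE.2 (Φ n ∪ Ψ)
    have heΨ := commonKer_antitone (Finset.subset_union_right (s₁ := Φ n)) heK
    have heΦ := commonKer_antitone (Finset.subset_union_left (s₂ := Ψ)) heK
    obtain ⟨v, hvE, hvΨ, hvΦ, hvn, hv⟩ : ∃ v ∈ E, v ∈ commonKer Ψ ∧ v ∈ commonKer (Φ n) ∧
        ‖v‖ = ρ ^ n ∧ ‖(T ^ n) v‖ ≤ ‖(T ^ n) (y + v)‖ := by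
      have hn : ‖((ρ ^ n : ℝ) : ℂ) • e‖ = ρ ^ n := by
        rw [norm_smul, Complex.norm_real, he1, mul_one, Real.norm_of_nonneg (by positivity)]
      rcases norm_le_norm_add_or_norm_sub ((T ^ n) y) ((T ^ n) (((ρ ^ n : ℝ) : ℂ) • e)) with h | h
      · exact ⟨_, E.smul_mem _ heE, Submodule.smul_mem _ _ heΨ, Submodule.smul_mem _ _ heΦ, hn,
          by rwa [map_add]⟩
      · exact ⟨_, E.neg_mem (E.smul_mem _ heE), Submodule.neg_mem _ (Submodule.smul_mem _ _ heΨ),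
          Submodule.neg_mem _ (Submodule.smul_mem _ _ heΦ), by rw [norm_neg, hn],
          by rwa [map_add, map_neg, norm_neg, ← sub_eq_add_neg]⟩
    obtain ⟨f, hf1, hf2⟩ := exists_dual_vector'' ℂ ((T ^ n) (y + v))
    refine ⟨(y + ⟨v, hvE⟩, insert (f.comp (T ^ n)) Ψ), ?_, ?_, Finset.subset_insert _ _,
      ⟨f, hf1, hf2, Finset.mem_insert_self _ _⟩, fun hn => ?_⟩
    · simp [hvn]
    · simpa using hvΨ
    · have h1 := hΦ n hn v hvΦ
      rw [hvn] at h1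
      exact h1.trans (mul_le_mul_of_nonneg_left hv (by positivity))
  choose g hg1 hg2 hg3 hg4 hg5 using hstep
  let s : ℕ → E × Finset (StrongDual ℂ X) := fun n => Nat.rec (0, ∅) (fun n t => g n t) n
  have hs : ∀ n, s (n + 1) = g n (s n) := fun n => rfl
  have : CompleteSpace E := hE.1.completeSpace_coe
  obtain ⟨x, hx⟩ : ∃ x, Tendsto (fun n => (s n).1) atTop (𝓝 x) := by
    refine cauchySeq_tendsto_of_complete (cauchySeq_of_le_geometric ρ 1 hρ1 fun n => ?_)
    rw [dist_comm, dist_eq_norm, one_mul]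
    exact hg1 n (s n)
  have hmono : Monotone fun n => (s n).2 := monotone_nat_of_le_succ fun n => hg3 n (s n)
  have hker : ∀ n m, n ≤ m → (((s m).1 - (s n).1 : E) : X) ∈ commonKer (s n).2 := by
    intro n m hnm
    induction m, hnm using Nat.le_induction with
    | base => simp
    | succ m hnm ih =>
      have h1 := commonKer_antitone (hmono hnm) (hg2 m (s m))
      have := Submodule.add_mem _ h1 ih
      rw [← Submodule.coe_add, sub_add_sub_cancel] at this
      exact this
  refine ⟨x, x.2, ?_⟩
  have hlow : ∀ n, N ≤ n → (1 / 2) * (ρ⁻¹) ^ n ≤ ‖(T ^ n) (x : X)‖ := by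
    intro n hn
    obtain ⟨f, hf1, hf2, hf3⟩ := hg4 n (s n)
    -- Later humps lie in the kernel of `f ∘ T ^ n`, so its value is frozen from stage `n + 1` on
    -- and passes to the limit.
    have hconst : ∀ m, n + 1 ≤ m → f ((T ^ n) ((s m).1 : X)) = f ((T ^ n) ((s (n + 1)).1 : X)) := by
      intro m hm
      have := hker (n + 1) m hm _ hf3
      rw [Submodule.coe_sub, map_sub, sub_eq_zero] at this
      exact this
    have hlim : Tendsto (fun m => f ((T ^ n) ((s m).1 : X))) atTop (𝓝 (f ((T ^ n) (x : X)))) :=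
      ((f.comp ((T ^ n).comp E.subtypeL)).continuous.tendsto x).comp hx
    have heq : f ((T ^ n) (x : X)) = ‖(T ^ n) ((s (n + 1)).1 : X)‖ := by
      rw [hs, ← hf2, ← hs]
      exact tendsto_nhds_unique hlim (tendsto_const_nhds.congr'
        ((eventually_ge_atTop (n + 1)).mono fun m hm => (hconst m hm).symm))
    have h1 : ‖(T ^ n) ((s (n + 1)).1 : X)‖ ≤ ‖(T ^ n) (x : X)‖ := by
      have h2 : ‖f ((T ^ n) (x : X))‖ = ‖(T ^ n) ((s (n + 1)).1 : X)‖ := by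
        rw [heq, Complex.norm_real, norm_norm]
      rw [← h2]
      exact (f.le_opNorm _).trans (mul_le_of_le_one_left (norm_nonneg _) hf1)
    have h3 := hg5 n (s n) hn
    rw [← hs, ← hρr, mul_pow] at h3
    have hρn : 0 < ρ ^ n := by positivity
    refine le_trans ?_ h1
    rw [inv_pow]
    have h4 : 1 ≤ 2 * ρ ^ n * ‖(T ^ n) ((s (n + 1)).1 : X)‖ := by
      refine le_of_mul_le_mul_left ?_ hρn
      linarith
    rw [← div_eq_mul_inv, div_le_iff₀ hρn]
    linarith
  refine tendsto_atTop_mono' _ ((eventually_ge_atTop N).mono hlow) ?_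
  exact (tendsto_pow_atTop_atTop_of_one_lt ((one_lt_inv₀ hρ0).2 hρ1)).const_mul_atTop (by norm_num)

/-- An operator with a recurrent subspace has essential spectrum meeting the closed unit disk. -/
theorem HasRecurrentSubspace.essentialSpectrum_inter_nonempty [CompleteSpace X] {T : X →L[ℂ] X}
    (h : HasRecurrentSubspace T) :
    (essentialSpectrum T ∩ Metric.closedBall (0 : ℂ) 1).Nonempty := by
  by_contra hcon
  obtain ⟨r, hr0, hr1, hr⟩ := exists_geometric_growth T hcon
  obtain ⟨Z, hZ, hrec⟩ := h
  obtain ⟨x, hxZ, hx⟩ := exists_tendsto_norm_pow_atTop T hr0 hr1 hr hZ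
  obtain ⟨k, hk, hkx⟩ := hrec x hxZ
  exact not_tendsto_atTop_of_tendsto_nhds hkx.norm (hx.comp hk.tendsto_atTop)

/-! ### Fredholm criteria and stability of finite codimension -/

theorem isCompactOperator_of_hasFiniteRange {K : X →L[ℂ] X}
    (hK : K.toLinearMap.HasFiniteRange) : IsCompactOperator K := by
  have : FiniteDimensional ℂ (LinearMap.range K.toLinearMap) := .of_fg hK
  have : ProperSpace (LinearMap.range K.toLinearMap) := FiniteDimensional.proper ℂ _
  exact (isCompactOperator_of_locallyCompactSpace_dom K.rangeRestrict).clm_comp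
    (LinearMap.range K.toLinearMap).subtypeL

open LinearMap.FiniteRangeSetoid in
/-- A Fredholm operator is invertible in the Calkin algebra. -/
theorem isUnit_toCalkin_of_isFredholm {A : X →L[ℂ] X}
    (hA : A.IsFredholm) : IsUnit (toCalkin A) := by
  obtain ⟨S, h1, h2⟩ := hA.exists_isQuasiInverse
  refine isUnit_toCalkin_of_isCompactOperator_sub (S := S) ?_ ?_
  · exact isCompactOperator_of_hasFiniteRange (equiv_iff_hasFiniteRange.1 h1)
  · exact isCompactOperator_of_hasFiniteRange (equiv_iff_hasFiniteRange.1 h2)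

theorem isClosed_map_of_bounded_below [CompleteSpace X] {A : X →L[ℂ] X} {M : Submodule ℂ X}
    (hM : IsClosed (M : Set X)) {c : ℝ} (hc : 0 < c) (h : ∀ x ∈ M, c * ‖x‖ ≤ ‖A x‖) :
    IsClosed (M.map A.toLinearMap : Set X) := by
  have : CompleteSpace M := hM.completeSpace_coe
  have hanti : AntilipschitzWith (Real.toNNReal c⁻¹) (A.comp M.subtypeL) := by
    refine AddMonoidHomClass.antilipschitz_of_bound _ fun x => ?_
    rw [Real.coe_toNNReal _ (by positivity), ← div_eq_inv_mul, le_div_iff₀ hc, mul_comm]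
    exact h x x.2
  convert hanti.isClosed_range (A.comp M.subtypeL).uniformContinuous
  ext y
  simp

/-- An operator that is bounded below on a closed subspace of finite codimension, with image of
finite codimension, is invertible in the Calkin algebra. -/
theorem isUnit_toCalkin_of_bounded_below [CompleteSpace X] {A : X →L[ℂ] X} {M : Submodule ℂ X}
    (hM : IsClosed (M : Set X)) (hMc : M.CoFG) {c : ℝ} (hc : 0 < c)
    (h : ∀ x ∈ M, c * ‖x‖ ≤ ‖A x‖) (hR : (M.map A.toLinearMap).CoFG) :
    IsUnit (toCalkin A) := by
  have hRc := isClosed_map_of_bounded_below hM hc h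
  have : CompleteSpace M := hM.completeSpace_coe
  have : CompleteSpace (M.map A.toLinearMap) := hRc.completeSpace_coe
  have hmaps : Set.MapsTo A M (M.map A.toLinearMap) := fun x hx => ⟨x, hx, rfl⟩
  -- `A` restricts to an isomorphism between closed subspaces of finite codimension.
  refine isUnit_toCalkin_of_isFredholm
    (ContinuousLinearMap.IsFredholm.of_isInvertible_restrict hM hRc hmaps ?_)
  refine ⟨ContinuousLinearEquiv.ofBijective (A.restrict hmaps) ?_ ?_, ?_⟩
  · refine LinearMap.ker_eq_bot'.2 fun x hx => ?_
    have hx0 : A x = 0 := congrArg Subtype.val hx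
    have := h x x.2
    rw [hx0, norm_zero] at this
    have : ‖(x : X)‖ = 0 := le_antisymm (by nlinarith) (norm_nonneg _)
    exact Subtype.ext (norm_eq_zero.1 this)
  · refine LinearMap.range_eq_top.2 ?_
    rintro ⟨_, x, hx, rfl⟩
    exact ⟨⟨x, hx⟩, rfl⟩
  · ext; rfl

/-- If `A` is bounded below on a closed subspace `M` and the images `B '' M` have codimension at
most `d` for operators `B` arbitrarily close to `A`, then `A '' M` has finite codimension. -/
theorem cofg_map_of_approx [CompleteSpace X] {A : X →L[ℂ] X} {M : Submodule ℂ X}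
    (hM : IsClosed (M : Set X)) {c : ℝ} (hc : 0 < c)
    (h : ∀ x ∈ M, c * ‖x‖ ≤ ‖A x‖) (d : ℕ)
    (happ : ∀ δ > 0, ∃ B : X →L[ℂ] X, ‖A - B‖ ≤ δ ∧ (M.map B.toLinearMap).CoFG ∧
      Module.finrank ℂ (X ⧸ M.map B.toLinearMap) ≤ d) :
    (M.map A.toLinearMap).CoFG := by
  have hRc := isClosed_map_of_bounded_below hM hc h
  by_contra hinf
  have hrank : Cardinal.aleph0 ≤ Module.rank ℂ (X ⧸ M.map A.toLinearMap) := by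
    rw [← not_lt, Module.rank_lt_aleph0_iff]
    exact hinf
  obtain ⟨w, hw⟩ := Module.le_rank_iff_exists_linearMap.1
    ((Cardinal.natCast_lt_aleph0 (n := d + 1)).le.trans hrank)
  obtain ⟨g, hg⟩ := (M.map A.toLinearMap).mkQ.exists_rightInverse_of_surjective
    (Submodule.range_mkQ _)
  -- `V` lifts `d + 1` independent directions of the quotient; `hVA` makes their transversality to
  -- `A M` quantitative.
  let V : (Fin (d + 1) → ℂ) →L[ℂ] X := LinearMap.toContinuousLinearMap (g ∘ₗ w)
  have hV : ∀ a, (M.map A.toLinearMap).mkQ (V a) = w a := fun a => LinearMap.congr_fun hg (w a)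
  obtain ⟨K, hK0, hK⟩ := w.injective_iff_antilipschitz.1 hw
  have hVA : ∀ a, ∀ m ∈ M, ‖a‖ ≤ K * ‖A m + V a‖ := by
    intro a m hm
    have h1 : ‖a‖ ≤ K * ‖w a‖ := by simpa using hK.le_mul_dist a 0
    have h2 : w a = (M.map A.toLinearMap).mkQ (A m + V a) := by
      rw [map_add, hV, right_eq_add, Submodule.mkQ_apply, Submodule.Quotient.mk_eq_zero]
      exact ⟨m, hm, rfl⟩
    refine h1.trans (mul_le_mul_of_nonneg_left ?_ K.2)
    rw [h2]
    exact Submodule.Quotient.norm_mk_le _ _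
  have hD : 0 < 1 + ‖V‖ * K := by positivity
  -- The tolerance is such that `B m = V a` yields `c * ‖m‖ ≤ c / 2 * ‖m‖`, so `m = 0` and then `a =
  -- 0`. Thus `B M` would have codimension at least `d + 1`.
  obtain ⟨B, hB, hBfin, hBd⟩ := happ (c / (2 * (1 + ‖V‖ * K))) (by positivity)
  have hinj : Function.Injective ((M.map B.toLinearMap).mkQ ∘ₗ V.toLinearMap) := by
    rw [← LinearMap.ker_eq_bot, LinearMap.ker_eq_bot']
    intro a ha
    obtain ⟨m, hm, hma⟩ : V a ∈ M.map B.toLinearMap := by simpa using ha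
    have hma : B m = V a := hma
    have h1 : ‖A (-m) + V a‖ ≤ c / (2 * (1 + ‖V‖ * K)) * ‖m‖ := by
      rw [← hma, map_neg, neg_add_eq_sub, norm_sub_rev]
      exact (A - B).le_of_opNorm_le hB m
    have h2 := hVA a (-m) (M.neg_mem hm)
    have h3 := h (-m) (M.neg_mem hm)
    rw [norm_neg] at h3
    have h4 : ‖A (-m)‖ ≤ ‖A (-m) + V a‖ + ‖V a‖ := norm_le_add_norm_add _ _
    have h5 := V.le_opNorm a
    have h6 : ‖V‖ * ‖a‖ ≤ ‖V‖ * (K * ‖A (-m) + V a‖) := by gcongr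
    have h7 : (1 + ‖V‖ * K) * ‖A (-m) + V a‖ ≤ c / 2 * ‖m‖ := by
      calc _ ≤ (1 + ‖V‖ * K) * (c / (2 * (1 + ‖V‖ * K)) * ‖m‖) := by gcongr
        _ = _ := by field_simp
    have h8 : ‖m‖ = 0 := le_antisymm (by nlinarith) (norm_nonneg _)
    rw [norm_eq_zero.1 h8, map_zero] at hma
    have h9 := hVA a 0 M.zero_mem
    rw [← hma] at h9
    simpa using h9
  have := LinearMap.finrank_le_finrank_of_injective hinj
  rw [Module.finrank_fin_fun] at this
  omega

/-! ### Approximate eigenvectors of quasi-rigid operators -/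

/-- A quasi-rigid operator minus a scalar of modulus less than one has dense range. -/
theorem IsQuasiRigid.denseRange_sub {T : X →L[ℂ] X} (hT : IsQuasiRigid T) {μ : ℂ}
    (hμ : ‖μ‖ < 1) : DenseRange (T - μ • ContinuousLinearMap.id ℂ X) := by
  obtain ⟨k, hk, Y, hY, hlim⟩ := hT
  set B := T - μ • ContinuousLinearMap.id ℂ X with hB
  by_contra hnd
  have hne : (LinearMap.range B.toLinearMap).topologicalClosure ≠ ⊤ := by
    intro htop
    refine hnd ?_
    rw [DenseRange, dense_iff_closure_eq]
    simpa [SetLike.ext'_iff, LinearMap.coe_range] using htop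
  obtain ⟨x, hx⟩ : ∃ x, x ∉ (LinearMap.range B.toLinearMap).topologicalClosure := by
    by_contra! hall
    exact hne (eq_top_iff.2 fun x _ => hall x)
  set S := (LinearMap.range B.toLinearMap).topologicalClosure with hS
  have : IsClosed (S : Set X) := Submodule.isClosed_topologicalClosure _
  have hx' : S.mkQ x ≠ 0 := by simpa using hx
  obtain ⟨g, -, hg⟩ := exists_dual_vector ℂ (S.mkQ x) (norm_ne_zero_iff.2 hx')
  let f : StrongDual ℂ X := g.comp S.mkQL
  have hfx : f x ≠ 0 := by
    change g (S.mkQ x) ≠ 0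
    rw [hg]
    exact Complex.ofReal_ne_zero.2 (norm_ne_zero_iff.2 hx')
  have hfT : ∀ y, f (T y) = μ * f y := by
    intro y
    have h0 : f (B y) = 0 := by
      have : S.mkQ (B y) = 0 := by
        rw [Submodule.mkQ_apply, Submodule.Quotient.mk_eq_zero]
        exact Submodule.le_topologicalClosure _ ⟨y, rfl⟩
      change g (S.mkQ (B y)) = 0
      rw [this, map_zero]
    rw [hB] at h0
    simpa [sub_eq_zero] using h0
  have hfTn : ∀ n y, f ((T ^ n) y) = μ ^ n * f y := by
    intro n y
    induction n with
    | zero => simp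
    | succ n ih =>
      rw [pow_succ' T, mul_apply_eq_comp, hfT, ih]
      ring
  -- `f` is an eigenvector of the adjoint for `μ`, so `f (T ^ k n y) = μ ^ k n * f y` tends both to
  -- 0 and to `f y`.
  have hfY : ∀ y ∈ Y, f y = 0 := by
    intro y hy
    have h1 : Tendsto (fun n => f ((T ^ k n) y)) atTop (𝓝 (f y)) :=
      (f.continuous.tendsto y).comp (hlim y hy)
    have h2 : Tendsto (fun n => f ((T ^ k n) y)) atTop (𝓝 0) := by
      simp only [hfTn]
      simpa using ((tendsto_pow_atTop_nhds_zero_of_norm_lt_one hμ).comp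
        hk.tendsto_atTop).mul_const (f y)
    exact tendsto_nhds_unique h1 h2
  have hf0 : (f : X → ℂ) = fun _ => 0 :=
    Continuous.ext_on hY f.continuous continuous_const hfY
  exact hfx (congrFun hf0 x)

/-- The range of `B` is `B M` plus a finite-dimensional space, hence closed; being dense, it is
everything, and `X ⧸ M` maps onto `X ⧸ B M`. The bound does not depend on `B`, as
`cofg_map_of_approx` requires. -/
theorem cofg_map_of_denseRange [CompleteSpace X] {B : X →L[ℂ] X} {M : Submodule ℂ X}
    (hMc : M.CoFG) (hR : IsClosed (M.map B.toLinearMap : Set X)) (hB : DenseRange B) :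
    (M.map B.toLinearMap).CoFG ∧
      Module.finrank ℂ (X ⧸ M.map B.toLinearMap) ≤ Module.finrank ℂ (X ⧸ M) := by
  have hcl := LinearMap.isClosed_range_of_isClosed_map_of_finiteDimensional_quotient hR
  have hsurj : Function.Surjective B := by
    have : IsClosed (Set.range B) := by simpa [LinearMap.coe_range] using hcl
    rw [← Set.range_eq_univ, ← this.closure_eq]
    exact hB.closure_range
  have hq : Function.Surjective
      (M.mapQ (M.map B.toLinearMap) B.toLinearMap (Submodule.le_comap_map _ _)) := by
    intro y
    obtain ⟨z, rfl⟩ := Submodule.mkQ_surjective _ y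
    obtain ⟨x, rfl⟩ := hsurj z
    exact ⟨M.mkQ x, rfl⟩
  exact ⟨Module.Finite.of_surjective _ hq, LinearMap.finrank_le_finrank_of_surjective hq⟩

/-- For a quasi-rigid operator `T`, every point `z` of the essential spectrum in the closed unit
disk is an approximate eigenvalue on every subspace of finite codimension. -/
theorem IsQuasiRigid.exists_approx_eigenvector [CompleteSpace X] {T : X →L[ℂ] X}
    (hT : IsQuasiRigid T) {z : ℂ} (hz : z ∈ essentialSpectrum T) (hz1 : ‖z‖ ≤ 1)
    (Φ : Finset (StrongDual ℂ X)) {ε : ℝ} (hε : 0 < ε) :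
    ∃ x ∈ commonKer Φ, ‖T x - z • x‖ < ε * ‖x‖ := by
  by_contra! hcon
  refine hz ?_
  have hMcl := isClosed_commonKer Φ
  refine isUnit_toCalkin_of_bounded_below hMcl (cofg_commonKer Φ) hε hcon
    (cofg_map_of_approx hMcl hε hcon (Module.finrank ℂ (X ⧸ commonKer Φ)) fun δ hδ => ?_)
  -- Since `z` may lie on the unit circle, it is replaced by `t * z` with `t < 1` close to 1; an
  -- error of `ε / 2` preserves a lower bound.
  obtain ⟨μ, hμ1, hμδ, hμε⟩ : ∃ μ : ℂ, ‖μ‖ < 1 ∧ ‖μ - z‖ ≤ δ ∧ ‖μ - z‖ ≤ ε / 2 := by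
    have hcont : Tendsto (fun t : ℝ => ‖(t : ℂ) * z - z‖) (𝓝[<] 1) (𝓝 0) := by
      have : Continuous fun t : ℝ => ‖(t : ℂ) * z - z‖ := by fun_prop
      simpa using (this.tendsto 1).mono_left nhdsWithin_le_nhds
    have hpos : ∀ᶠ t : ℝ in 𝓝[<] 1, 0 < t :=
      nhdsWithin_le_nhds (lt_mem_nhds one_pos)
    obtain ⟨t, ⟨⟨h1, h2⟩, h3⟩, h4⟩ := (((hcont.eventually_lt_const hδ).and
      (hcont.eventually_lt_const (half_pos hε))).and hpos |>.and self_mem_nhdsWithin).exists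
    refine ⟨t * z, ?_, h1.le, h2.le⟩
    rw [norm_mul, Complex.norm_real, Real.norm_of_nonneg h3.le]
    have : t < 1 := h4
    nlinarith [norm_nonneg z]
  have hbelow : ∀ x ∈ commonKer Φ,
      ε / 2 * ‖x‖ ≤ ‖(T - μ • ContinuousLinearMap.id ℂ X) x‖ := by
    intro x hx
    have h1 : ε * ‖x‖ ≤ ‖T x - z • x‖ := hcon x hx
    have h2 : T x - z • x = (T x - μ • x) + (μ - z) • x := by rw [sub_smul]; abel
    have h3 : ‖T x - z • x‖ ≤ ‖T x - μ • x‖ + ‖μ - z‖ * ‖x‖ := by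
      rw [h2, ← norm_smul]
      exact norm_add_le _ _
    have h4 : ‖μ - z‖ * ‖x‖ ≤ ε / 2 * ‖x‖ := by gcongr
    change _ ≤ ‖T x - μ • x‖
    linarith
  refine ⟨T - μ • ContinuousLinearMap.id ℂ X, ?_, cofg_map_of_denseRange (cofg_commonKer Φ)
    (isClosed_map_of_bounded_below hMcl (half_pos hε) hbelow) (hT.denseRange_sub hμ1)⟩
  rw [sub_sub_sub_cancel_left, ← sub_smul, norm_smul]
  exact (mul_le_of_le_one_right (norm_nonneg _) ContinuousLinearMap.norm_id_le).trans hμδ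

/-- The subspace of all vectors fixed in the limit by the powers of `T` along `k`. -/
def rigidityDomain (T : X →L[ℂ] X) (k : ℕ → ℕ) : Submodule ℂ X where
  carrier := {x | Tendsto (fun n => (T ^ k n) x) atTop (𝓝 x)}
  add_mem' {x y} hx hy := by
    change Tendsto (fun n => (T ^ k n) (x + y)) atTop (𝓝 (x + y))
    simpa only [map_add] using Tendsto.add hx hy
  zero_mem' := by simp
  smul_mem' c x hx := by
    change Tendsto (fun n => (T ^ k n) (c • x)) atTop (𝓝 (c • x))
    simpa only [map_smul] using Tendsto.const_smul hx c

/-- A dense subspace is dense in every common kernel of finitely many functionals. -/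
theorem commonKer_subset_closure_inf {D : Submodule ℂ X} (hD : Dense (D : Set X))
    (Φ : Finset (StrongDual ℂ X)) :
    (commonKer Φ : Set X) ⊆ closure ((D ⊓ commonKer Φ : Submodule ℂ X) : Set X) := by
  classical
  induction Φ using Finset.induction_on with
  | empty =>
    intro x _
    refine closure_mono (s := (D : Set X)) (fun y hy => ?_) (hD x)
    exact ⟨hy, fun f hf => absurd hf (Finset.notMem_empty f)⟩
  | insert f Φ _ ih =>
    intro x hx
    have hxΦ : x ∈ commonKer Φ := commonKer_antitone (Finset.subset_insert f Φ) hx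
    have hxf : f x = 0 := hx f (Finset.mem_insert_self f Φ)
    have hins : ∀ y ∈ commonKer Φ, f y = 0 → y ∈ commonKer (insert f Φ) := by
      intro y hy hfy g hg
      rcases Finset.mem_insert.1 hg with rfl | hg
      exacts [hfy, hy g hg]
    by_cases hz : ∀ y ∈ D ⊓ commonKer Φ, f y = 0
    · refine closure_mono (s := ((D ⊓ commonKer Φ : Submodule ℂ X) : Set X))
        (fun y hy => ?_) (ih hxΦ)
      exact ⟨hy.1, hins y hy.2 (hz y hy)⟩
    · push Not at hz
      obtain ⟨z, hzD, hfz⟩ := hz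
      -- Projecting along `z` onto `ker f` stays inside `D ⊓ commonKer Φ` and fixes `x`.
      have hcont : Continuous fun y : X => y - (f y * (f z)⁻¹) • z := by fun_prop
      have := map_mem_closure (t := ((D ⊓ commonKer (insert f Φ) : Submodule ℂ X) : Set X))
        hcont (ih hxΦ) fun y hy => by
          have hmem := (D ⊓ commonKer Φ).sub_mem hy
            ((D ⊓ commonKer Φ).smul_mem (f y * (f z)⁻¹) hzD)
          exact ⟨hmem.1, hins _ hmem.2 (by simp [hfz])⟩
      simpa [hxf] using this

/-- Approximate eigenvectors are approximate eigenvectors of the powers. -/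
theorem exists_norm_pow_sub_le (T : X →L[ℂ] X) {z : ℂ} (hz : ‖z‖ ≤ 1) (N : ℕ) :
    ∃ C : ℝ, 0 < C ∧ ∀ n ≤ N, ∀ x, ‖(T ^ n) x - z ^ n • x‖ ≤ C * ‖T x - z • x‖ := by
  induction N with
  | zero => exact ⟨1, one_pos, fun n hn x => by
      obtain rfl := Nat.le_zero.1 hn
      simp⟩
  | succ N ih =>
    obtain ⟨C, hC, h⟩ := ih
    refine ⟨‖T‖ * C + 1 + C, by positivity, fun n hn x => ?_⟩
    have hd := norm_nonneg (T x - z • x)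
    rcases Nat.le_succ_iff.1 hn with hn | rfl
    · have h1 := h n hn x
      have : 0 ≤ (‖T‖ * C + 1) * ‖T x - z • x‖ := by positivity
      linarith
    · have heq : (T ^ (N + 1)) x - z ^ (N + 1) • x =
          T ((T ^ N) x - z ^ N • x) + z ^ N • (T x - z • x) := by
        rw [pow_succ' T, mul_apply_eq_comp, map_sub, map_smul, smul_sub,
          smul_smul, ← pow_succ]
        abel
      have h1 : ‖T ((T ^ N) x - z ^ N • x)‖ ≤ ‖T‖ * (C * ‖T x - z • x‖) :=
        (T.le_opNorm _).trans (by gcongr; exact h N le_rfl x)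
      have h2 : ‖z ^ N • (T x - z • x)‖ ≤ ‖T x - z • x‖ := by
        rw [norm_smul, norm_pow]
        exact mul_le_of_le_one_left hd (pow_le_one₀ (norm_nonneg _) hz)
      rw [heq]
      refine (norm_add_le _ _).trans ?_
      have : 0 ≤ C * ‖T x - z • x‖ := by positivity
      linarith

/-- For a quasi-rigid operator, approximate eigenvectors can be found in the intersection of a
dense subspace with any common kernel of finitely many functionals. -/
theorem IsQuasiRigid.exists_approx_eigenvector_pow [CompleteSpace X] {T : X →L[ℂ] X}
    (hT : IsQuasiRigid T) {z : ℂ} (hz : z ∈ essentialSpectrum T) (hz1 : ‖z‖ ≤ 1)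
    {D : Submodule ℂ X} (hD : Dense (D : Set X)) (Φ : Finset (StrongDual ℂ X)) (N : ℕ)
    {ε : ℝ} (hε : 0 < ε) :
    ∃ e ∈ D, e ∈ commonKer Φ ∧ ‖e‖ = 1 ∧ ∀ n ≤ N, ‖(T ^ n) e - z ^ n • e‖ ≤ ε := by
  obtain ⟨C, hC, hpow⟩ := exists_norm_pow_sub_le T hz1 N
  obtain ⟨x, hxΦ, hx⟩ := hT.exists_approx_eigenvector hz hz1 Φ (div_pos hε hC)
  -- The strict inequality is an open condition, so it persists at some nearby vector of the dense
  -- subspace.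
  have hopen : IsOpen {y : X | ‖T y - z • y‖ < ε / C * ‖y‖} :=
    isOpen_lt (by fun_prop) (by fun_prop)
  obtain ⟨y, hy, hyD, hyΦ⟩ := mem_closure_iff.1 (commonKer_subset_closure_inf hD Φ hxΦ) _ hopen hx
  have hy : ‖T y - z • y‖ < ε / C * ‖y‖ := hy
  have hyn : 0 < ‖y‖ := by
    rcases (norm_nonneg y).eq_or_lt with h | h
    · rw [← h, mul_zero] at hy
      exact absurd hy (norm_nonneg _).not_gt
    · exact h
  have hc : ‖(‖y‖⁻¹ : ℂ)‖ = ‖y‖⁻¹ := by rw [norm_inv, Complex.norm_real, norm_norm]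
  refine ⟨(‖y‖⁻¹ : ℂ) • y, D.smul_mem _ hyD, (commonKer Φ).smul_mem _ hyΦ, ?_, fun n hn => ?_⟩
  · rw [norm_smul, hc, inv_mul_cancel₀ hyn.ne']
  · refine (hpow n hn _).trans ?_
    rw [map_smul, smul_comm z, ← smul_sub, norm_smul, hc]
    have : ‖y‖⁻¹ * ‖T y - z • y‖ ≤ ε / C := by
      rw [inv_mul_le_iff₀ hyn, mul_comm]
      exact hy.le
    calc _ ≤ C * (ε / C) := by gcongr
      _ = ε := by field_simp

/-- Finitely many functionals norm a finite-dimensional subspace up to a factor of two. -/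
theorem exists_commonKer_norm_le (F : Submodule ℂ X) [FiniteDimensional ℂ F] :
    ∃ Φ : Finset (StrongDual ℂ X), ∀ u ∈ F, ∀ v ∈ commonKer Φ, ‖u‖ ≤ 2 * ‖u + v‖ := by
  classical
  have : ProperSpace F := FiniteDimensional.proper ℂ F
  have htb : TotallyBounded ((fun u : F => (u : X)) '' Metric.sphere 0 1) :=
    ((isCompact_sphere (0 : F) 1).image continuous_subtype_val).totallyBounded
  -- With a `1 / 4`-net, `‖y‖ ≥ 3 / 4` and `‖g y u‖ ≥ 3 / 4 - 1 / 4 = 1 / 2`, while `g y` kills `v`.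
  obtain ⟨t, htf, ht⟩ := Metric.totallyBounded_iff.1 htb (1 / 4) (by positivity)
  choose g hg1 hg2 using fun y : X => exists_dual_vector'' ℂ y
  refine ⟨htf.toFinset.image g, ?_⟩
  have key : ∀ u ∈ F, ‖u‖ = 1 → ∀ v ∈ commonKer (htf.toFinset.image g), 1 ≤ 2 * ‖u + v‖ := by
    intro u hu hu1 v hv
    obtain ⟨y, hyt, hy⟩ := Set.mem_iUnion₂.1 (ht ⟨⟨u, hu⟩, by simpa using hu1, rfl⟩)
    rw [mem_ball_iff_norm] at hy
    have hgv : g y v = 0 := hv (g y) (Finset.mem_image_of_mem _ (htf.mem_toFinset.2 hyt))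
    have hle : ∀ w, ‖g y w‖ ≤ ‖w‖ := fun w =>
      ((g y).le_opNorm _).trans (mul_le_of_le_one_left (norm_nonneg _) (hg1 y))
    have h1 := hle (u + v)
    rw [map_add, hgv, add_zero] at h1
    have h2 := hle (u - y)
    rw [map_sub] at h2
    have h3 : ‖g y y‖ = ‖y‖ := by rw [hg2, RCLike.norm_ofReal, abs_norm]
    have h4 := norm_le_norm_add_norm_sub (g y u) (g y y)
    have h5 := norm_le_norm_add_norm_sub y u
    rw [norm_sub_rev] at h5
    linarith
  intro u hu v hv
  rcases eq_or_ne u 0 with rfl | hu0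
  · simp
  have hun : 0 < ‖u‖ := norm_pos_iff.2 hu0
  have hc : ‖(‖u‖⁻¹ : ℂ)‖ = ‖u‖⁻¹ := by rw [norm_inv, Complex.norm_real, norm_norm]
  have h1 := key ((‖u‖⁻¹ : ℂ) • u) (F.smul_mem _ hu)
    (by rw [norm_smul, hc, inv_mul_cancel₀ hun.ne']) _ ((commonKer _).smul_mem (‖u‖⁻¹ : ℂ) hv)
  rw [← smul_add, norm_smul, hc, mul_left_comm, ← div_eq_inv_mul, le_div_iff₀ hun] at h1
  linarith

/-- The convergence `T ^ k n → 1` is uniform on finite-dimensional subspaces of the domain of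
rigidity. -/
theorem eventually_norm_pow_sub_le {T : X →L[ℂ] X} {k : ℕ → ℕ} {F : Submodule ℂ X}
    [FiniteDimensional ℂ F] (hF : F ≤ rigidityDomain T k) {ε : ℝ} (hε : 0 < ε) :
    ∀ᶠ n in atTop, ∀ u ∈ F, ‖(T ^ k n) u - u‖ ≤ ε * ‖u‖ := by
  let b := Module.finBasis ℂ F
  obtain ⟨C, hC, hb⟩ := b.exists_opNorm_le (F := X)
  have h1 : ∀ᶠ n in atTop, ∀ i, ‖(T ^ k n) (b i) - b i‖ ≤ ε / C := by
    refine eventually_all.2 fun i => ?_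
    have h2 : Tendsto (fun n => ‖(T ^ k n) (b i) - b i‖) atTop (𝓝 0) := by
      simpa using ((hF (b i).2).sub_const (b i : X)).norm
    exact (h2.eventually_lt_const (div_pos hε hC)).mono fun _ h => h.le
  filter_upwards [h1] with n hn u hu
  have := hb (u := (T ^ k n - 1).comp F.subtypeL) (M := ε / C) (by positivity) hn
  rw [mul_div_cancel₀ _ hC.ne'] at this
  exact ((T ^ k n - 1).comp F.subtypeL).le_of_opNorm_le this ⟨u, hu⟩

/-! ### The adapted basic sequence and its closed span -/

/-- A sequence of unit vectors `e n` with a norming sequence of finite sets of functionals `Φ n` for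
the increasing chain `F n` of their spans, adapted to the powers `T ^ l n`. -/
structure AdaptedSequence (T : X →L[ℂ] X) (z : ℂ) where
  /-- the unit vectors -/
  e : ℕ → X
  /-- the chain of spans -/
  F : ℕ → Submodule ℂ X
  /-- the norming functionals -/
  Φ : ℕ → Finset (StrongDual ℂ X)
  /-- the exponents -/
  l : ℕ → ℕ
  norm_e : ∀ n, ‖e n‖ = 1
  F_zero : F 0 = ⊥
  F_succ : ∀ n, F (n + 1) = F n ⊔ Submodule.span ℂ {e n}
  Φ_mono : Monotone Φ
  e_mem_commonKer : ∀ n, e n ∈ commonKer (Φ n)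
  norm_le : ∀ n, ∀ u ∈ F n, ∀ v ∈ commonKer (Φ n), ‖u‖ ≤ 2 * ‖u + v‖
  l_strictMono : StrictMono l
  -- `e n` is chosen after `l n` and controls all powers up to it; `l (n + 1)` is chosen after `e n`
  -- and controls `F (n + 1)`.
  pow_e : ∀ n, ∀ i ≤ l n, ‖(T ^ i) (e n) - z ^ i • e n‖ ≤ (1 / 2) ^ n
  pow_F : ∀ n, ∀ u ∈ F (n + 1), ‖(T ^ l (n + 1)) u - u‖ ≤ (1 / 2) ^ n * ‖u‖

/-- A quasi-rigid operator has an adapted sequence for every point of the essential spectrum in the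
closed unit disk. -/
theorem IsQuasiRigid.nonempty_adaptedSequence [CompleteSpace X] {T : X →L[ℂ] X}
    (hT : IsQuasiRigid T) {z : ℂ} (hz : z ∈ essentialSpectrum T) (hz1 : ‖z‖ ≤ 1) :
    Nonempty (AdaptedSequence T z) := by
  classical
  obtain ⟨k, hk, Y, hY, hlim⟩ := id hT
  have hD : Dense (rigidityDomain T k : Set X) := hY.mono hlim
  let P : X × Submodule ℂ X × Finset (StrongDual ℂ X) × ℕ → Prop := fun s =>
    FiniteDimensional ℂ s.2.1 ∧ s.2.1 ≤ rigidityDomain T k ∧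
      ∀ u ∈ s.2.1, ∀ v ∈ commonKer s.2.2.1, ‖u‖ ≤ 2 * ‖u + v‖
  have hstep : ∀ (n : ℕ) (s : {s // P s}), ∃ s' : {s // P s},
      ‖s'.1.1‖ = 1 ∧ s'.1.2.1 = s.1.2.1 ⊔ Submodule.span ℂ {s'.1.1} ∧
      s.1.2.2.1 ⊆ s'.1.2.2.1 ∧ s'.1.1 ∈ commonKer s.1.2.2.1 ∧ s.1.2.2.2 < s'.1.2.2.2 ∧
      (∀ i ≤ s.1.2.2.2, ‖(T ^ i) s'.1.1 - z ^ i • s'.1.1‖ ≤ (1 / 2) ^ n) ∧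
      ∀ u ∈ s'.1.2.1, ‖(T ^ s'.1.2.2.2) u - u‖ ≤ (1 / 2) ^ n * ‖u‖ := by
    rintro n ⟨⟨e₀, F, Φ, l⟩, hfin, hFD, hnorm⟩
    have hfin : FiniteDimensional ℂ F := hfin
    obtain ⟨e, heD, heΦ, he1, hepow⟩ :=
      hT.exists_approx_eigenvector_pow hz hz1 hD Φ l (ε := (1 / 2) ^ n) (by positivity)
    have hF'D : F ⊔ Submodule.span ℂ {e} ≤ rigidityDomain T k :=
      sup_le hFD ((Submodule.span_singleton_le_iff_mem _ _).2 heD)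
    obtain ⟨Ψ, hΨ⟩ := exists_commonKer_norm_le (F ⊔ Submodule.span ℂ {e})
    obtain ⟨m, hm, hml⟩ := ((eventually_norm_pow_sub_le hF'D (ε := (1 / 2) ^ n)
      (by positivity)).and (hk.tendsto_atTop.eventually_gt_atTop l)).exists
    refine ⟨⟨⟨e, F ⊔ Submodule.span ℂ {e}, Φ ∪ Ψ, k m⟩, inferInstance, hF'D, fun u hu v hv => ?_⟩,
      he1, rfl, Finset.subset_union_left, heΦ, hml, hepow, hm⟩
    exact hΨ u hu v (commonKer_antitone Finset.subset_union_right hv)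
  choose g hg1 hg2 hg3 hg4 hg5 hg6 hg7 using hstep
  let s₀ : {s // P s} := ⟨⟨0, ⊥, ∅, 0⟩, inferInstanceAs (FiniteDimensional ℂ (⊥ : Submodule ℂ X)),
    bot_le, fun u hu v _ => by
      rw [(Submodule.mem_bot ℂ).1 hu]
      simp⟩
  let s : ℕ → {s // P s} := fun n => Nat.rec s₀ (fun n t => g n t) n
  exact ⟨{
    -- Each state stores the vector just added, hence the shift; the 0 in `s₀` is never used.
    e := fun n => (s (n + 1)).1.1
    F := fun n => (s n).1.2.1
    Φ := fun n => (s n).1.2.2.1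
    l := fun n => (s n).1.2.2.2
    norm_e := fun n => hg1 n (s n)
    F_zero := rfl
    F_succ := fun n => hg2 n (s n)
    Φ_mono := monotone_nat_of_le_succ fun n => hg3 n (s n)
    e_mem_commonKer := fun n => hg4 n (s n)
    norm_le := fun n => (s n).2.2.2
    l_strictMono := strictMono_nat_of_lt_succ fun n => hg5 n (s n)
    pow_e := fun n => hg6 n (s n)
    pow_F := fun n => hg7 n (s n) }⟩

namespace AdaptedSequence

variable {T : X →L[ℂ] X} {z : ℂ} (A : AdaptedSequence T z)

theorem F_mono : Monotone A.F := monotone_nat_of_le_succ fun n => by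
  rw [A.F_succ]
  exact le_sup_left

theorem e_mem (n : ℕ) : A.e n ∈ A.F (n + 1) := by
  rw [A.F_succ]
  exact Submodule.mem_sup_right (Submodule.mem_span_singleton_self _)

theorem e_notMem (n : ℕ) : A.e n ∉ A.F n := by
  intro h
  have := A.norm_le n _ h _ ((commonKer _).neg_mem (A.e_mem_commonKer n))
  rw [add_neg_cancel, A.norm_e, norm_zero] at this
  norm_num at this

theorem sum_mem (a : ℕ → ℂ) (n : ℕ) : ∑ j ∈ Finset.range n, a j • A.e j ∈ A.F n :=
  Submodule.sum_mem _ fun j hj => (A.F n).smul_mem _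
    (A.F_mono (Nat.succ_le_of_lt (Finset.mem_range.1 hj)) (A.e_mem j))

theorem exists_eq_sum {n : ℕ} {x : X} (hx : x ∈ A.F n) :
    ∃ a : ℕ → ℂ, x = ∑ j ∈ Finset.range n, a j • A.e j := by
  induction n generalizing x with
  | zero =>
    rw [A.F_zero, Submodule.mem_bot] at hx
    exact ⟨0, by simpa using hx⟩
  | succ n ih =>
    rw [A.F_succ] at hx
    obtain ⟨y, hy, w, hw, rfl⟩ := Submodule.mem_sup.1 hx
    obtain ⟨c, rfl⟩ := Submodule.mem_span_singleton.1 hw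
    obtain ⟨a, rfl⟩ := ih hy
    refine ⟨Function.update a n c, ?_⟩
    rw [Finset.sum_range_succ, Function.update_self]
    congr 1
    refine Finset.sum_congr rfl fun j hj => ?_
    rw [Function.update_of_ne (Finset.mem_range.1 hj).ne]

theorem sum_Ico_mem_commonKer (a : ℕ → ℂ) (m n : ℕ) :
    ∑ j ∈ Finset.Ico m n, a j • A.e j ∈ commonKer (A.Φ m) :=
  Submodule.sum_mem _ fun j hj => (commonKer _).smul_mem _
    (commonKer_antitone (A.Φ_mono (Finset.mem_Ico.1 hj).1) (A.e_mem_commonKer j))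

/-- The criterion for a basic sequence, with basis constant 2: the tail lies in the kernel of
functionals norming the head. -/
theorem norm_sum_range_le (a : ℕ → ℂ) {m n : ℕ} (h : m ≤ n) :
    ‖∑ j ∈ Finset.range m, a j • A.e j‖ ≤ 2 * ‖∑ j ∈ Finset.range n, a j • A.e j‖ := by
  rw [← Finset.sum_range_add_sum_Ico _ h]
  exact A.norm_le m _ (A.sum_mem a m) _ (A.sum_Ico_mem_commonKer a m n)

/-- A term is the difference of two consecutive partial sums, each at most `2 * ‖x‖`. -/
theorem norm_coeff_le (a : ℕ → ℂ) {j n : ℕ} (h : j < n) :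
    ‖a j‖ ≤ 4 * ‖∑ i ∈ Finset.range n, a i • A.e i‖ := by
  have h1 := A.norm_sum_range_le a (Nat.succ_le_of_lt h)
  have h2 := A.norm_sum_range_le a h.le
  rw [Nat.succ_eq_add_one, Finset.sum_range_succ] at h1
  have h3 : ‖a j‖ = ‖a j • A.e j‖ := by rw [norm_smul, A.norm_e, mul_one]
  have h4 := norm_le_add_norm_add (a j • A.e j) (∑ i ∈ Finset.range j, a i • A.e i)
  rw [add_comm (a j • A.e j)] at h4
  linarith

theorem sum_half_pow_Ico_le (m n : ℕ) : ∑ j ∈ Finset.Ico m n, (1 / 2 : ℝ) ^ j ≤ 2 :=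
  (Finset.sum_le_sum_of_subset_of_nonneg (t := Finset.range n)
    (fun j hj => Finset.mem_range.2 (Finset.mem_Ico.1 hj).2) fun _ _ _ => by positivity).trans
    (sum_geometric_two_le n)

/-- The powers `T ^ l m`, `m ≥ 1`, are uniformly bounded on the spans. -/
theorem norm_pow_le_of_mem (hz : ‖z‖ ≤ 1) (m : ℕ) {N : ℕ} {x : X} (hx : x ∈ A.F N) :
    ‖(T ^ A.l (m + 1)) x‖ ≤ 15 * ‖x‖ := by
  obtain ⟨n, hmn, hx⟩ : ∃ n, m + 1 ≤ n ∧ x ∈ A.F n :=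
    ⟨max N (m + 1), le_max_right _ _, A.F_mono (le_max_left _ _) hx⟩
  obtain ⟨a, rfl⟩ := A.exists_eq_sum hx
  set x := ∑ j ∈ Finset.range n, a j • A.e j with hxdef
  -- The head contributes at most `2 * ‖u‖ ≤ 4 * ‖x‖`; the tail at most `8 * ‖x‖ + ‖v‖ ≤ 11 * ‖x‖`,
  -- whence 15.
  set u := ∑ j ∈ Finset.range (m + 1), a j • A.e j with hu
  set v := ∑ j ∈ Finset.Ico (m + 1) n, a j • A.e j with hv
  have hxuv : x = u + v := (Finset.sum_range_add_sum_Ico _ hmn).symm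
  have h1 : ‖u‖ ≤ 2 * ‖x‖ := A.norm_sum_range_le a hmn
  have h2 : ‖v‖ ≤ ‖u‖ + ‖x‖ := by
    rw [hxuv, add_comm ‖u‖]
    exact norm_le_add_norm_add' u v
  have h3 : ‖(T ^ A.l (m + 1)) u - u‖ ≤ ‖u‖ :=
    (A.pow_F m u (A.sum_mem a (m + 1))).trans (mul_le_of_le_one_left (norm_nonneg _)
      (pow_le_one₀ (by norm_num) (by norm_num)))
  have h4 : ‖(T ^ A.l (m + 1)) v - z ^ A.l (m + 1) • v‖ ≤ 8 * ‖x‖ := by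
    rw [hv, map_sum, Finset.smul_sum, ← Finset.sum_sub_distrib]
    calc _ ≤ ∑ j ∈ Finset.Ico (m + 1) n, 4 * ‖x‖ * (1 / 2) ^ j := by
          refine norm_sum_le_of_le _ fun j hj => ?_
          obtain ⟨hmj, hjn⟩ := Finset.mem_Ico.1 hj
          rw [map_smul, smul_comm (z ^ _), ← smul_sub, norm_smul]
          exact mul_le_mul (A.norm_coeff_le a hjn)
            (A.pow_e j _ (A.l_strictMono.monotone hmj)) (norm_nonneg _) (by positivity)
      _ = 4 * ‖x‖ * ∑ j ∈ Finset.Ico (m + 1) n, (1 / 2) ^ j := by rw [Finset.mul_sum]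
      _ ≤ 4 * ‖x‖ * 2 := by gcongr; exact sum_half_pow_Ico_le _ _
      _ = 8 * ‖x‖ := by ring
  have h5 : ‖z ^ A.l (m + 1) • v‖ ≤ ‖v‖ := by
    rw [norm_smul, norm_pow]
    exact mul_le_of_le_one_left (norm_nonneg _) (pow_le_one₀ (norm_nonneg _) hz)
  have h6 : ‖(T ^ A.l (m + 1)) x‖ ≤ ‖(T ^ A.l (m + 1)) u‖ + ‖(T ^ A.l (m + 1)) v‖ := by
    rw [hxuv, map_add]
    exact norm_add_le _ _
  have h7 := norm_le_norm_sub_add ((T ^ A.l (m + 1)) u) u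
  have h8 := norm_le_norm_sub_add ((T ^ A.l (m + 1)) v) (z ^ A.l (m + 1) • v)
  linarith

/-- The closed linear span of the sequence. -/
def closedSpan : Submodule ℂ X := (⨆ n, A.F n).topologicalClosure

theorem F_le_closedSpan (n : ℕ) : A.F n ≤ A.closedSpan :=
  (le_iSup A.F n).trans (Submodule.le_topologicalClosure _)

theorem exists_mem_F_norm_sub_lt {x : X} (hx : x ∈ A.closedSpan) {ε : ℝ} (hε : 0 < ε) :
    ∃ n, ∃ w ∈ A.F n, ‖x - w‖ < ε := by
  obtain ⟨w, hw, hxw⟩ := Metric.mem_closure_iff.1 hx ε hε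
  obtain ⟨n, hn⟩ := (Submodule.mem_iSup_of_directed _ A.F_mono.directed_le).1 hw
  exact ⟨n, w, hn, by rwa [← dist_eq_norm]⟩

theorem finrank_F_ge (n : ℕ) [FiniteDimensional ℂ A.closedSpan] :
    n ≤ Module.finrank ℂ (A.F n) := by
  induction n with
  | zero => exact Nat.zero_le _
  | succ n ih =>
    have : FiniteDimensional ℂ (A.F (n + 1)) :=
      Submodule.finiteDimensional_of_le (A.F_le_closedSpan (n + 1))
    have hlt : A.F n < A.F (n + 1) :=
      lt_of_le_of_ne (A.F_mono n.le_succ) fun h => A.e_notMem n (h ▸ A.e_mem n)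
    exact Nat.succ_le_of_lt (ih.trans_lt (Submodule.finrank_lt_finrank_of_lt hlt))

theorem isInfDimClosed_closedSpan : IsInfDimClosed A.closedSpan := by
  refine ⟨Submodule.isClosed_topologicalClosure _, fun hfin => ?_⟩
  have h1 := A.finrank_F_ge (Module.finrank ℂ A.closedSpan + 1)
  have h2 := Submodule.finrank_mono (A.F_le_closedSpan (Module.finrank ℂ A.closedSpan + 1))
  omega

theorem norm_pow_le (hz : ‖z‖ ≤ 1) (m : ℕ) {x : X} (hx : x ∈ A.closedSpan) :
    ‖(T ^ A.l (m + 1)) x‖ ≤ 15 * ‖x‖ := by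
  have hcl : IsClosed {y : X | ‖(T ^ A.l (m + 1)) y‖ ≤ 15 * ‖y‖} :=
    isClosed_le (by fun_prop) (by fun_prop)
  refine hcl.closure_subset_iff.2 (fun w hw => ?_) hx
  obtain ⟨n, hn⟩ := (Submodule.mem_iSup_of_directed _ A.F_mono.directed_le).1 hw
  exact A.norm_pow_le_of_mem hz m hn

/-- Convergence holds on the dense union of the `F n`, and the uniform bound 15 carries it to the
closure. -/
theorem tendsto_pow (hz : ‖z‖ ≤ 1) {x : X} (hx : x ∈ A.closedSpan) :
    Tendsto (fun m => (T ^ A.l (m + 1)) x) atTop (𝓝 x) := by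
  rw [Metric.tendsto_atTop']
  intro ε hε
  -- The errors add up as `15 * (ε / 32) + ε / 2 + ε / 32 = ε`.
  obtain ⟨n, w, hw, hxw⟩ := A.exists_mem_F_norm_sub_lt hx (ε := ε / 32) (by positivity)
  have hlim : Tendsto (fun m : ℕ => (1 / 2 : ℝ) ^ m * ‖w‖) atTop (𝓝 0) := by
    simpa using (tendsto_pow_atTop_nhds_zero_of_lt_one (by norm_num : (0 : ℝ) ≤ 1 / 2)
      (by norm_num)).mul_const ‖w‖
  obtain ⟨N, hN⟩ := eventually_atTop.1 (hlim.eventually_lt_const (half_pos hε))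
  refine ⟨max N n, fun m hm => ?_⟩
  have h1 : ‖(T ^ A.l (m + 1)) w - w‖ < ε / 2 :=
    (A.pow_F m w (A.F_mono ((le_max_right N n).trans (hm.le.trans m.le_succ)) hw)).trans_lt
      (hN m ((le_max_left N n).trans hm.le))
  have h2 := A.norm_pow_le hz m (A.closedSpan.sub_mem hx (A.F_le_closedSpan n hw))
  have h3 : (T ^ A.l (m + 1)) x - x =
      (T ^ A.l (m + 1)) (x - w) + ((T ^ A.l (m + 1)) w - w) + (w - x) := by
    rw [map_sub]; abel
  rw [dist_eq_norm, h3]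
  have h4 := norm_add₃_le (a := (T ^ A.l (m + 1)) (x - w)) (b := (T ^ A.l (m + 1)) w - w)
    (c := w - x)
  rw [norm_sub_rev w x] at h4
  linarith

end AdaptedSequence

end OperatorTheory

theorem mainTheorem2 {X : Type*} [NormedAddCommGroup X] [NormedSpace ℂ X] [CompleteSpace X]
    [TopologicalSpace.SeparableSpace X] (T : X →L[ℂ] X) (hT : IsQuasiRigid T) :
    List.TFAE [
      HasRecurrentSubspace T,
      ∃ E : Submodule ℂ X, IsInfDimClosed E ∧ ∃ l : ℕ → ℕ, StrictMono l ∧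
        ∀ x ∈ E, Tendsto (fun n => (T ^ l n) x) atTop (𝓝 x),
      ∃ E : Submodule ℂ X, IsInfDimClosed E ∧ ∃ l : ℕ → ℕ, StrictMono l ∧
        BddAbove (Set.range fun n => ‖(T ^ l n).comp E.subtypeL‖),
      (essentialSpectrum T ∩ Metric.closedBall (0 : ℂ) 1).Nonempty] := by
  tfae_have 1 → 4 := HasRecurrentSubspace.essentialSpectrum_inter_nonempty
  tfae_have 2 → 1 := fun ⟨E, hE, l, hl, h⟩ => ⟨E, hE, fun x hx => ⟨l, hl, h x hx⟩⟩
  tfae_have 2 → 3 := by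
    rintro ⟨E, hE, l, hl, h⟩
    refine ⟨E, hE, l, hl, ?_⟩
    have : CompleteSpace E := hE.1.completeSpace_coe
    obtain ⟨C, hC⟩ := banach_steinhaus (g := fun n => (T ^ l n).comp E.subtypeL) fun x => by
      obtain ⟨C, hC⟩ := (h x x.2).norm.bddAbove_range
      exact ⟨C, fun n => hC ⟨n, rfl⟩⟩
    exact ⟨C, Set.forall_mem_range.2 hC⟩
  tfae_have 3 → 4 := fun ⟨E, hE, l, hl, h⟩ =>
    essentialSpectrum_inter_nonempty_of_bddAbove T hE.2 hl h
  -- The only implication that needs quasi-rigidity. The exponents start at `l 1`, the first one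
  -- that `pow_F` controls.
  tfae_have 4 → 2 := by
    rintro ⟨z, hz, hz1⟩
    have hz1 : ‖z‖ ≤ 1 := by simpa using hz1
    obtain ⟨A⟩ := hT.nonempty_adaptedSequence hz hz1
    exact ⟨A.closedSpan, A.isInfDimClosed_closedSpan, fun m => A.l (m + 1),
      fun _ _ h => A.l_strictMono (Nat.succ_lt_succ h), fun x hx => A.tendsto_pow hz1 hx⟩
  tfae_finish
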